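/- **Setting.** Let $\mathbb F_q$ be a finite field and let $N,M,X,T$ be integers with $M\ge 1$, $0\le X\le N$, $1\le T\le N$. There are $N$ servers and $M$ sets of messages; the $m$-th set consists of $K_m$ messages $W_{m,1},\dots,W_{m,K_m}$ and is stored at the servers in a given set $\mathcal R_m\subseteq\{1,\dots,N\}$. Put $\rho_{\min}=\min_m|\mathcal R_m|$. All random variables below have finite alphabets and entropies $H$ are in $q$-ary units. A *feasible scheme* consists of a message length $L\ge 1$ and of the following random variables on a common probability space. - *Messages.* The messages are independent, and each is uniform on $\mathbb F_q^L$. - *Storage.* Each message $W_{m,k}$ has shares $W_{m,k}^{(n)}$, $n\in\mathcal R_m$; server $n$ stores $S_n=\{W_{m,k}^{(n)}: \mathcal R_m\ni n\}$. The share tuples $(W_{m,k}^{(n)})_{n\in\mathcal R_m}$ of the different messages are independent, and each message is determined by its shares. If $X=0$, every share is a copy of its message. - *$X$-security.* For every set $\mathcal X$ of at most $X$ servers, $(S_n)_{n\in\mathcal X}$ is independent of all the messages. - *Queries.* The desired index $(\mu,\kappa)$ is random, with $\mu$ uniform on $\{1,\dots,M\}$ and $\kappa$ uniform on $\{1,\dots,K_\mu\}$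 given $\mu$. There are queries $Q_n^{[m,k]}$, and $(S_1,\dots,S_N)$ is independent of $(\mu,\kappa)$ together with all the queries $Q_n^{[m,k]}$. Server $n$ receives $Q_n^{[\mu,\kappa]}$. - *$T$-privacy.* For every set $\mathcal T$ of at most $T$ servers, $(Q_n^{[\mu,\kappa]})_{n\in\mathcal T}$ is independent of $(\mu,\kappa)$. - *Answers.* Server $n$ returns $A_n^{[\mu,\kappa]}$, a fixed function of $Q_n^{[\mu,\kappa]}$ and $S_n$. - *Correctness.* $W_{\mu,\kappa}$ is determined by $(\mu,\kappa)$ and all the queries $Q_n^{[\mu,\kappa]}$ and answers $A_n^{[\mu,\kappa]}$, $1\le n\le N$. The *rate* of the scheme is $L/D$, where $D=\sum_{n=1}^N H(A_n^{[\mu,\kappa]})$. The *capacity* is the supremum of the rates of all feasible schemes, over all $L\ge1$ (it is $0$ if there is no feasible scheme). Given constants $\chi_1,\dots,\chi_M>0$, the *asymptotic capacity* $C_\infty$ is the limit, as $K\to\infty$, of the capacity for $K_m=\lceil\chi_mK\rceil$, $1\le m\le M$, with $\mathbb F_q,N,M,X,T$ and $\mathcal R_1,\dots,\mathcal R_M$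 fixed. **Theorem 1.** For every finite field $\mathbb F_q$, all $N,M,X,T$ as above, all sets $\mathcal R_1,\dots,\mathcal R_M\subseteq\{1,\dots,N\}$ and all constants $\chi_1,\dots,\chi_M>0$, the limit $C_\infty$ exists and $$C_\infty\;\ge\;\frac{\rho_{\min}-X-T}{N}.$$ -/

import Mathlib

open MeasureTheory ProbabilityTheory Filter Topology
open scoped ENNReal

namespace GXSTPIR

noncomputable section

/-- Entropy, in units of base `b`, of a random variable `U` with a finite alphabet. -/
def entropy {Ω α : Type} [MeasurableSpace Ω] [Fintype α] (b : ℕ) (P : Measure Ω)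
    (U : Ω → α) : ℝ :=
  ∑ a : α, Real.negMulLog (P.real (U ⁻¹' {a})) / Real.log b

/-- The set of message indices `(m, k)` with `k ∈ [K_m]`. -/
abbrev Idx {M : ℕ} (K : Fin M → ℕ) : Type := Σ m : Fin M, Fin (K m)

/-- The minimum replication factor `min_m |R_m|` (used with at least one message set). -/
def rhoMin {N M : ℕ} (R : Fin M → Finset (Fin N)) : ℕ := ⨅ m : Fin M, (R m).card

/-- The objects that make up a retrieval scheme over the finite field `F`, for `N` servers, where
the `m`-th message set has `K m` messages and is stored at the servers in `R m`. All random
variables live on one probability space and have finite alphabets: `𝒮` for shares, `𝒬` for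
queries, `𝒜` for answers. The constraints are collected in `Scheme.Feasible`. -/
structure Scheme (F : Type) {N M : ℕ} (R : Fin M → Finset (Fin N)) (K : Fin M → ℕ) where
  /-- number of symbols of each message -/
  L : ℕ
  Ω : Type
  𝒮 : Type
  𝒬 : Type
  𝒜 : Type
  [measΩ : MeasurableSpace Ω]
  [fin𝒮 : Fintype 𝒮]
  [meas𝒮 : MeasurableSpace 𝒮]
  [disc𝒮 : DiscreteMeasurableSpace 𝒮]
  [fin𝒬 : Fintype 𝒬]
  [meas𝒬 : MeasurableSpace 𝒬]
  [disc𝒬 : DiscreteMeasurableSpace 𝒬]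
  [fin𝒜 : Fintype 𝒜]
  P : Measure Ω
  /-- the index `(μ, κ)` of the desired message -/
  θ : Ω → Idx K
  /-- the messages `W_{m,k}` -/
  W : Idx K → Ω → (Fin L → F)
  /-- the share of message `(m, k)` that is stored at server `n`, for `n ∈ R m` -/
  share : (i : Idx K) → {n : Fin N // n ∈ R i.1} → Ω → 𝒮
  /-- the query to server `n` when message `i` is desired -/
  Q : Idx K → Fin N → Ω → 𝒬
  /-- the answer of server `n`, as a function of the received query and of its storage -/
  answer : (n : Fin N) → 𝒬 → ({i : Idx K // n ∈ R i.1} → 𝒮) → 𝒜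

namespace Scheme

attribute [instance] measΩ fin𝒮 meas𝒮 disc𝒮 fin𝒬 meas𝒬 disc𝒬 fin𝒜

variable {F : Type} {N M : ℕ} {R : Fin M → Finset (Fin N)} {K : Fin M → ℕ}

/-- All the shares of message `i`. -/
def shares (s : Scheme F R K) (i : Idx K) (ω : s.Ω) : {n : Fin N // n ∈ R i.1} → s.𝒮 :=
  fun n => s.share i n ω

/-- The storage `S_n` of server `n`. -/
def storage (s : Scheme F R K) (n : Fin N) (ω : s.Ω) : {i : Idx K // n ∈ R i.1} → s.𝒮 :=
  fun i => s.share i.1 ⟨n, i.2⟩ ω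

/-- The joint storage of the servers in `B`. -/
def storageOn (s : Scheme F R K) (B : Finset (Fin N)) (ω : s.Ω) :
    (n : B) → ({i : Idx K // n.1 ∈ R i.1} → s.𝒮) :=
  fun n => s.storage n.1 ω

/-- The queries `Q_n^{[μ,κ]}` that are sent for the (random) desired index. -/
def sentQuery (s : Scheme F R K) (n : Fin N) (ω : s.Ω) : s.𝒬 := s.Q (s.θ ω) n ω

/-- The answers `A_n^{[μ,κ]}` that are downloaded. -/
def sentAnswer (s : Scheme F R K) (n : Fin N) (ω : s.Ω) : s.𝒜 :=
  s.answer n (s.sentQuery n ω) (s.storage n ω)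

/-- The constraints of `X`-secure `T`-private retrieval. Zero mutual information is stated as
independence, and zero conditional entropy as almost sure functional dependence. -/
structure Feasible [Fintype F] [MeasurableSpace F] (X T : ℕ) (s : Scheme F R K) : Prop where
  prob : IsProbabilityMeasure s.P
  pos_L : 0 < s.L
  meas_θ : Measurable s.θ
  meas_W : ∀ i, Measurable (s.W i)
  meas_share : ∀ i n, Measurable (s.share i n)
  meas_Q : ∀ i n, Measurable (s.Q i n)
  /-- `μ` is uniform on `[M]` and, given `μ`, `κ` is uniform on `[K_μ]`. -/
  law_θ : ∀ i : Idx K, s.P.real (s.θ ⁻¹' {i}) = 1 / ((M : ℝ) * (K i.1 : ℝ))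
  /-- Each message consists of `L` i.i.d. uniform symbols. -/
  law_W : ∀ i w, s.P.real (s.W i ⁻¹' {w}) = 1 / (Fintype.card F : ℝ) ^ s.L
  /-- The messages are independent. -/
  indep_W : iIndepFun s.W s.P
  /-- The messages are independently secured. -/
  indep_shares : iIndepFun s.shares s.P
  /-- Each message is recoverable from its shares. -/
  recover : ∀ i, ∃ g : ({n : Fin N // n ∈ R i.1} → s.𝒮) → (Fin s.L → F),
    ∀ᵐ ω ∂s.P, s.W i ω = g (s.shares i ω)
  /-- `X`-security. -/
  secure : ∀ B : Finset (Fin N), B.card ≤ X →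
    IndepFun (s.storageOn B) (fun ω i => s.W i ω) s.P
  /-- Without a security constraint each share is a copy of the message. -/
  copy : X = 0 → ∀ i n, ∃ c : (Fin s.L → F) → s.𝒮, Function.Injective c ∧
    ∀ᵐ ω ∂s.P, s.share i n ω = c (s.W i ω)
  /-- The user has no prior knowledge of the stored data. -/
  indep_user : IndepFun (fun ω n => s.storage n ω) (fun ω => (s.θ ω, fun i n => s.Q i n ω)) s.P
  /-- `T`-privacy. -/
  priv : ∀ B : Finset (Fin N), B.card ≤ T →
    IndepFun (fun ω => fun n : B => s.sentQuery n.1 ω) s.θ s.P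
  /-- The desired message is determined by the answers, the queries and the desired index. -/
  correct : ∃ dec : (Fin N → s.𝒜) → (Fin N → s.𝒬) → Idx K → (Fin s.L → F),
    ∀ᵐ ω ∂s.P, s.W (s.θ ω) ω =
      dec (fun n => s.sentAnswer n ω) (fun n => s.sentQuery n ω) (s.θ ω)

/-- The total download `D = ∑_n H(A_n^{[μ,κ]})`, in `q`-ary units. -/
def download [Fintype F] (s : Scheme F R K) : ℝ :=
  ∑ n : Fin N, entropy (Fintype.card F) s.P (s.sentAnswer n)

/-- The rate `L / D`. -/
def rate [Fintype F] (s : Scheme F R K) : ℝ≥0∞ := (s.L : ℝ≥0∞) / ENNReal.ofReal s.download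

end Scheme

/-- The capacity: the supremum of the rates of all feasible schemes (`0` if there is none). -/
def capacity (F : Type) [Fintype F] [MeasurableSpace F] {N M : ℕ} (X T : ℕ)
    (R : Fin M → Finset (Fin N)) (K : Fin M → ℕ) : ℝ≥0∞ :=
  ⨆ (s : Scheme F R K) (_ : s.Feasible X T), s.rate

/-- `C` is the asymptotic capacity: the limit of the capacity with `K_m = ⌈χ_m K⌉` messages in the
`m`-th message set, as `K → ∞`. -/
def IsAsymptoticCapacity (F : Type) [Fintype F] [MeasurableSpace F] {N M : ℕ} (X T : ℕ)
    (R : Fin M → Finset (Fin N)) (χ : Fin M → ℝ) (C : ℝ≥0∞) : Prop :=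
  Tendsto (fun K : ℕ => capacity F X T R (fun m => ⌈χ m * (K : ℝ)⌉₊)) atTop (𝓝 C)

end

end GXSTPIR

namespace GXSTPIR

/-! The limit exists because the capacity is antitone in the numbers of messages (`capacity_anti`).
A scheme for `K'` messages per set yields one for `K ≤ K'`: change the measure so that the desired
message lies among the first `K` of its set, and put the shares of the remaining messages into the
queries as common randomness (`Scheme.restrict`). The density depends on `θ` alone. The stored data,
and each single answer (as `1 ≤ T`), are independent of `θ`, so their laws, and hence the download,
do not change.

The lower bound comes from cross-subspace alignment with `ℓ = ρ_min - X - T`, over a field `E` of `q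
^ r` elements with at least `N + ℓ` points. Shares and queries are values at `α n` of polynomials of
degree at most `X` and `T` whose values at `β l` are a message symbol and the indicator of the
desired index. For `h` of degree below `ℓ`, the product of `h`, share and query has degree below `|R
m|`, so the barycentric weights of `R m` turn its values at the servers into its value at `β l`,
which vanishes for undesired messages (`alignmentScheme_sum_answer`). Letting `h` run through the
Lagrange basis of the `β l` recovers `ℓ` symbols of `E` from `N` answers in `E`. This rate `ℓ / N`
does not depend on `K`, so it passes to the limit. -/

instance Idx.instDiscreteMeasurableSpace {M : ℕ} {K : Fin M → ℕ} :
    DiscreteMeasurableSpace (Idx K) where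
  forall_measurableSet s := by
    refine MeasurableSpace.measurableSet_iInf.2 fun m => ?_
    exact MeasurableSet.of_discrete (s := Sigma.mk m ⁻¹' s)

/-! ### Entropy of finite random variables. -/

section Entropy

variable {Ω Ω' α : Type} [MeasurableSpace Ω] [MeasurableSpace Ω'] [Fintype α] [MeasurableSpace α]
  [DiscreteMeasurableSpace α]

lemma entropy_eq_of_map_eq (b : ℕ) {P : Measure Ω} {P' : Measure Ω'} {U : Ω → α} {U' : Ω' → α}
    (hU : Measurable U) (hU' : Measurable U') (h : P.map U = P'.map U') :
    entropy b P U = entropy b P' U' := by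
  unfold entropy
  refine Finset.sum_congr rfl fun a _ => ?_
  rw [← map_measureReal_apply hU (measurableSet_singleton a), h,
    map_measureReal_apply hU' (measurableSet_singleton a)]

lemma entropy_le_log_card {b : ℕ} (hb : 1 < b) (P : Measure Ω) [IsProbabilityMeasure P]
    {U : Ω → α} (hU : Measurable U) :
    entropy b P U ≤ Real.log (Fintype.card α) / Real.log b := by
  unfold entropy
  rw [← Finset.sum_div]
  refine div_le_div_of_nonneg_right ?_ (Real.log_nonneg (by exact_mod_cast hb.le))
  have hsum : ∑ a : α, P.real (U ⁻¹' {a}) = 1 := by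
    rw [sum_measureReal_preimage_singleton _ fun a _ => hU (measurableSet_singleton a)]
    simp
  have : Nonempty α := by
    by_contra hne
    rw [not_nonempty_iff] at hne
    simp at hsum
  have hn : (0 : ℝ) < Fintype.card α := by exact_mod_cast Fintype.card_pos
  -- Jensen's inequality with equal weights; the mean of the probabilities is `1 / |α|`.
  have key := Real.concaveOn_negMulLog.le_map_sum (t := (Finset.univ : Finset α))
    (w := fun _ => (Fintype.card α : ℝ)⁻¹) (p := fun a => P.real (U ⁻¹' {a}))
    (fun _ _ => by positivity) (by simp [hn.ne']) (fun _ _ => measureReal_nonneg)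
  simp only [smul_eq_mul, ← Finset.mul_sum, hsum, mul_one] at key
  rw [Real.negMulLog, Real.log_inv, neg_mul_neg] at key
  exact le_of_mul_le_mul_left key (by positivity)

end Entropy

/-! ### Independence under measure-preserving maps and changes of measure. -/

section Independence

variable {Ω Ω' α β : Type*} [MeasurableSpace Ω] [MeasurableSpace Ω'] [MeasurableSpace α]
  [MeasurableSpace β]

lemma IndepFun.comp_measurePreserving {P : Measure Ω} {P' : Measure Ω'} {e : Ω → Ω'}
    (he : MeasurePreserving e P P') {f : Ω' → α} {g : Ω' → β} (hf : Measurable f)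
    (hg : Measurable g) (h : IndepFun f g P') :
    IndepFun (fun ω => f (e ω)) (fun ω => g (e ω)) P := by
  rw [indepFun_iff_measure_inter_preimage_eq_mul] at h ⊢
  intro s t hs ht
  have := h s t hs ht
  rw [← he.map_eq, Measure.map_apply he.measurable ((hf hs).inter (hg ht)),
    Measure.map_apply he.measurable (hf hs), Measure.map_apply he.measurable (hg ht)] at this
  exact this

lemma iIndepFun.comp_measurePreserving {ι : Type*} {γ : ι → Type*} [∀ i, MeasurableSpace (γ i)]
    {P : Measure Ω} {P' : Measure Ω'} {e : Ω → Ω'}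
    (he : MeasurePreserving e P P') {f : ∀ i, Ω' → γ i} (hf : ∀ i, Measurable (f i))
    (h : iIndepFun f P') : iIndepFun (fun i ω => f i (e ω)) P := by
  rw [iIndepFun_iff_measure_inter_preimage_eq_mul] at h ⊢
  intro S sets hS
  have := h S hS
  rw [← he.map_eq, Measure.map_apply he.measurable
    (S.measurableSet_biInter fun i hi => hf i (hS i hi))] at this
  rw [Finset.prod_congr rfl fun i hi => Measure.map_apply he.measurable (hf i (hS i hi))] at this
  simp only [Set.preimage_iInter] at this
  exact this

/-- If the second component of a product measure is shifted by maps that preserve its law, the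
result is independent of the first component. -/
lemma indepFun_skew_fst {μ : Measure α} {ν : Measure β} [IsProbabilityMeasure μ]
    [IsProbabilityMeasure ν] {σ : α → β → β} (hσ : Measurable (Function.uncurry σ))
    (hν : ∀ a, MeasurePreserving (σ a) ν ν) :
    IndepFun (fun p : α × β => σ p.1 p.2) Prod.fst (μ.prod ν) := by
  have hskew : MeasurePreserving (fun p : α × β => (p.1, σ p.1 p.2)) (μ.prod ν) (μ.prod ν) :=
    (MeasurePreserving.id μ).skew_product hσ (Eventually.of_forall fun a => (hν a).map_eq)
  have h : IndepFun (Prod.snd : α × β → β) Prod.fst (μ.prod ν) :=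
    (indepFun_prod (X := id) (Y := id) measurable_id measurable_id).symm
  exact IndepFun.comp_measurePreserving hskew measurable_snd measurable_fst h

/-- Reweighting by a function of `V` affects only the factor of `V` in the joint law of `V` and an
independent variable `U`. -/
lemma withDensity_inter_preimage {P : Measure Ω} {U : Ω → α} {V : Ω → β} (hU : Measurable U)
    (hV : Measurable V) (hUV : IndepFun U V P) {f : β → ℝ≥0∞} (hf : Measurable f)
    {s : Set α} {t : Set β} (hs : MeasurableSet s) (ht : MeasurableSet t) :
    P.withDensity (fun ω => f (V ω)) (U ⁻¹' s ∩ V ⁻¹' t) =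
      P (U ⁻¹' s) * P.withDensity (fun ω => f (V ω)) (V ⁻¹' t) := by
  rw [withDensity_apply _ ((hU hs).inter (hV ht)), withDensity_apply _ (hV ht),
    ← lintegral_indicator ((hU hs).inter (hV ht)), ← lintegral_indicator (hV ht)]
  have h1 : Measurable (s.indicator (1 : α → ℝ≥0∞)) := measurable_one.indicator hs
  have h2 : Measurable (t.indicator f) := hf.indicator ht
  have key := lintegral_mul_eq_lintegral_mul_lintegral_of_indepFun (h1.comp hU) (h2.comp hV)
    (hUV.comp h1 h2)
  have e1 : (U ⁻¹' s ∩ V ⁻¹' t).indicator (fun ω => f (V ω)) =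
      (s.indicator 1 ∘ U) * (t.indicator f ∘ V) := by
    ext ω
    by_cases h₁ : U ω ∈ s <;> by_cases h₂ : V ω ∈ t <;> simp [h₁, h₂]
  have e2 : (V ⁻¹' t).indicator (fun ω => f (V ω)) = t.indicator f ∘ V := rfl
  have e3 : ∫⁻ ω, (s.indicator (1 : α → ℝ≥0∞) ∘ U) ω ∂P = P (U ⁻¹' s) :=
    lintegral_indicator_one (hU hs)
  rw [e1, e2, key, e3]

/-- Both hypotheses together factor the joint law into three marginals, which can then be regrouped.
This is how shares of other messages are moved to the side of the user. -/
lemma IndepFun.prodMk_of_prodMk {γ : Type*} [MeasurableSpace γ] {P : Measure Ω}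
    [IsProbabilityMeasure P] {A : Ω → α} {B : Ω → β} {C : Ω → γ} (hA : Measurable A)
    (hB : Measurable B) (hC : Measurable C) (hAB : IndepFun A B P)
    (hABC : IndepFun (fun ω => (A ω, B ω)) C P) : IndepFun A (fun ω => (B ω, C ω)) P := by
  have := Measure.isProbabilityMeasure_map (μ := P) hA.aemeasurable
  have := Measure.isProbabilityMeasure_map (μ := P) hB.aemeasurable
  have := Measure.isProbabilityMeasure_map (μ := P) hC.aemeasurable
  have hBC : IndepFun B C P := hABC.comp measurable_snd measurable_id
  rw [indepFun_iff_map_prod_eq_prod_map_map hA.aemeasurable hB.aemeasurable] at hAB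
  rw [indepFun_iff_map_prod_eq_prod_map_map hB.aemeasurable hC.aemeasurable] at hBC
  rw [indepFun_iff_map_prod_eq_prod_map_map (hA.prodMk hB).aemeasurable hC.aemeasurable,
    hAB] at hABC
  rw [indepFun_iff_map_prod_eq_prod_map_map hA.aemeasurable (hB.prodMk hC).aemeasurable, hBC,
    ← (measurePreserving_prodAssoc (P.map A) (P.map B) (P.map C)).map_eq, ← hABC,
    Measure.map_map MeasurableEquiv.prodAssoc.measurable ((hA.prodMk hB).prodMk hC)]
  rfl

variable {P : Measure Ω} {U : Ω → α} {V : Ω → β} {f : β → ℝ≥0∞}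

/-- The factor that belongs to `V` is the total mass of the new measure, which is one. -/
lemma map_withDensity_eq (hU : Measurable U) (hV : Measurable V) (hUV : IndepFun U V P)
    (hf : Measurable f) [IsProbabilityMeasure (P.withDensity fun ω => f (V ω))] :
    (P.withDensity fun ω => f (V ω)).map U = P.map U := by
  ext s hs
  rw [Measure.map_apply hU hs, Measure.map_apply hU hs]
  simpa using withDensity_inter_preimage hU hV hUV hf hs MeasurableSet.univ

lemma indepFun_withDensity (hU : Measurable U) (hV : Measurable V) (hUV : IndepFun U V P)
    (hf : Measurable f) [IsProbabilityMeasure (P.withDensity fun ω => f (V ω))] :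
    IndepFun U V (P.withDensity fun ω => f (V ω)) := by
  rw [indepFun_iff_measure_inter_preimage_eq_mul]
  intro s t hs ht
  rw [withDensity_inter_preimage hU hV hUV hf hs ht, ← Measure.map_apply hU hs,
    ← Measure.map_apply hU hs, map_withDensity_eq hU hV hUV hf]

end Independence

/-! ### Uniform measures on finite types. -/

section Uniform

variable {α : Type*} [Finite α] [MeasurableSpace α] [DiscreteMeasurableSpace α]

lemma measurePreserving_uniformOn_univ (e : α ≃ α) :
    MeasurePreserving e (uniformOn Set.univ) (uniformOn Set.univ) := by
  have := Fintype.ofFinite α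
  refine ⟨.of_discrete, ?_⟩
  ext s -
  rw [Measure.map_apply .of_discrete .of_discrete, uniformOn_univ, uniformOn_univ,
    Measure.count_apply .of_discrete, Measure.count_apply .of_discrete]
  rw [Set.encard_preimage_of_bijective e.bijective]

lemma uniformOn_univ_singleton [Fintype α] (a : α) :
    uniformOn Set.univ {a} = (Fintype.card α : ℝ≥0∞)⁻¹ := by
  simp [uniformOn_univ]

end Uniform

/-! ### Monotonicity of the capacity: discarding messages. -/

section Restriction

variable {F : Type} {N M : ℕ} {R : Fin M → Finset (Fin N)} {K K' : Fin M → ℕ}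

/-- The inclusion of message indices when the message sets grow. -/
def Idx.castLE (h : ∀ m, K m ≤ K' m) (i : Idx K) : Idx K' := ⟨i.1, Fin.castLE (h i.1) i.2⟩

lemma Idx.castLE_injective (h : ∀ m, K m ≤ K' m) : Function.Injective (Idx.castLE h) := by
  rintro ⟨m, k⟩ ⟨m', k'⟩ e
  obtain rfl : m = m' := congrArg Sigma.fst e
  simpa [Idx.castLE] using e

/-- A left inverse of `Idx.castLE`. -/
def Idx.trunc (hK : ∀ m, 0 < K m) (j : Idx K') : Idx K :=
  -- The default index `0` matters only on a null set of `truncMeasure`.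
  if hj : (j.2 : ℕ) < K j.1 then ⟨j.1, ⟨j.2, hj⟩⟩ else ⟨j.1, ⟨0, hK j.1⟩⟩

lemma Idx.trunc_castLE (h : ∀ m, K m ≤ K' m) (hK : ∀ m, 0 < K m) (i : Idx K) :
    Idx.trunc hK (Idx.castLE h i) = i := by
  have : ((Idx.castLE h i).2 : ℕ) < K (Idx.castLE h i).1 := i.2.2
  rw [Idx.trunc, dif_pos this]
  rfl

lemma Idx.castLE_trunc (h : ∀ m, K m ≤ K' m) (hK : ∀ m, 0 < K m) {j : Idx K'}
    (hj : (j.2 : ℕ) < K j.1) : Idx.castLE h (Idx.trunc hK j) = j := by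
  rw [Idx.trunc, dif_pos hj]
  rfl

/-- The likelihood ratio that turns the uniform choice among `K'` messages of each set into the
uniform choice among the first `K`. -/
noncomputable def truncWeight (K K' : Fin M → ℕ) (j : Idx K') : ℝ≥0∞ :=
  -- The ratio varies with the set; plain conditioning on the event would bias the law of `μ`.
  if (j.2 : ℕ) < K j.1 then ENNReal.ofReal ((K' j.1 : ℝ) / K j.1) else 0

namespace Scheme

/-- The measure under which the desired message is one of the first `K` of its set. -/
noncomputable def truncMeasure (s : Scheme F R K') (K : Fin M → ℕ) : Measure s.Ω :=
  s.P.withDensity fun ω => truncWeight K K' (s.θ ω)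

/-- The scheme for the first `K` messages of each set, in which the shares of the other messages
become common randomness of the queries. -/
noncomputable def restrict (s : Scheme F R K') (h : ∀ m, K m ≤ K' m) (hK : ∀ m, 0 < K m) :
    Scheme F R K where
  L := s.L
  Ω := s.Ω
  𝒮 := s.𝒮
  𝒬 := s.𝒬 × ((j : {j : Idx K' // ¬ (j.2 : ℕ) < K j.1}) → {n : Fin N // n ∈ R j.1.1} → s.𝒮)
  𝒜 := s.𝒜
  fin𝒬 := Fintype.ofFinite _
  P := s.truncMeasure K
  θ ω := Idx.trunc hK (s.θ ω)
  W i := s.W (Idx.castLE h i)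
  share i := s.share (Idx.castLE h i)
  -- The index argument is ignored, since only the query for the actual `θ` is ever sent. The
  -- answers then agree with those of `s` everywhere, not just almost surely.
  Q _ n ω := (s.sentQuery n ω, fun j => s.shares j.1 ω)
  answer n q S := s.answer n q.1 fun j =>
    if hj : (j.1.2 : ℕ) < K j.1.1 then S ⟨⟨j.1.1, ⟨j.1.2, hj⟩⟩, j.2⟩ else q.2 ⟨j.1, hj⟩ ⟨n, j.2⟩

lemma restrict_sentAnswer (s : Scheme F R K') (h : ∀ m, K m ≤ K' m) (hK : ∀ m, 0 < K m)
    (n : Fin N) : (s.restrict h hK).sentAnswer n = s.sentAnswer n := by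
  funext ω
  show s.answer n _ _ = s.answer n _ _
  congr 1
  funext j
  by_cases hj : (j.1.2 : ℕ) < K j.1.1
  · exact (dif_pos hj).trans rfl
  · exact (dif_neg hj).trans rfl

lemma absolutelyContinuous_truncMeasure (s : Scheme F R K') : s.truncMeasure K ≪ s.P :=
  withDensity_absolutelyContinuous _ _

variable [Fintype F] [MeasurableSpace F] {X T : ℕ} {s : Scheme F R K'}

namespace Feasible

lemma measurable_storages (hs : s.Feasible X T) : Measurable fun ω n => s.storage n ω :=
  measurable_pi_lambda _ fun _ => measurable_pi_lambda _ fun _ => hs.meas_share _ _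

lemma measurable_user (hs : s.Feasible X T) :
    Measurable fun ω => (s.θ ω, fun i n => s.Q i n ω) :=
  hs.meas_θ.prodMk <| measurable_pi_lambda _ fun _ => measurable_pi_lambda _ fun _ => hs.meas_Q _ _

lemma measurable_sentQuery (hs : s.Feasible X T) (n : Fin N) : Measurable (s.sentQuery n) :=
  (Measurable.of_discrete (f := fun p : Idx K' × (Idx K' → Fin N → s.𝒬) => p.2 p.1 n)).comp
    hs.measurable_user

lemma measurable_shares (hs : s.Feasible X T) (i : Idx K') : Measurable (s.shares i) :=
  measurable_pi_lambda _ fun _ => hs.meas_share _ _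

/-- Privacy is strengthened by adjoining the whole storage, because the queries of the restricted
scheme contain shares. -/
lemma indep_θ_queries_storages (hs : s.Feasible X T) {B : Finset (Fin N)} (hB : B.card ≤ T) :
    IndepFun s.θ (fun ω => ((fun n : B => s.sentQuery n.1 ω), fun n => s.storage n ω)) s.P := by
  have := hs.prob
  refine IndepFun.prodMk_of_prodMk hs.meas_θ
    (measurable_pi_lambda _ fun n => hs.measurable_sentQuery n.1) hs.measurable_storages
    (hs.priv B hB).symm ?_
  exact hs.indep_user.symm.comp
    (Measurable.of_discrete (f := fun p : Idx K' × (Idx K' → Fin N → s.𝒬) =>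
    (p.1, fun n : B => p.2 p.1 n.1)))
    measurable_id

lemma truncMeasure_singleton (hs : s.Feasible X T) (h : ∀ m, K m ≤ K' m) (hK : ∀ m, 0 < K m)
    (i : Idx K) : s.truncMeasure K (s.θ ⁻¹' {Idx.castLE h i}) =
      ENNReal.ofReal (1 / ((M : ℝ) * (K i.1 : ℝ))) := by
  have := hs.prob
  have hm : MeasurableSet (s.θ ⁻¹' {Idx.castLE h i}) := hs.meas_θ .of_discrete
  have hi : ((Idx.castLE h i).2 : ℕ) < K (Idx.castLE h i).1 := i.2.2
  have hK0 : (0 : ℝ) < K i.1 := by exact_mod_cast hK i.1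
  have hK0' : (0 : ℝ) < K' i.1 := by exact_mod_cast (hK i.1).trans_le (h i.1)
  rw [truncMeasure, withDensity_apply _ hm, setLIntegral_congr_fun (g := fun _ =>
      ENNReal.ofReal ((K' i.1 : ℝ) / K i.1)) hm, setLIntegral_const, ← ofReal_measureReal,
    hs.law_θ, ← ENNReal.ofReal_mul (by positivity)]
  · congr 1
    simp only [Idx.castLE]
    field_simp
  · intro ω hω
    simp only [Set.mem_preimage, Set.mem_singleton_iff] at hω
    show truncWeight K K' (s.θ ω) = _
    rw [hω]
    exact if_pos hi

lemma ae_truncMeasure (hs : s.Feasible X T) :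
    ∀ᵐ ω ∂(s.truncMeasure K), ((s.θ ω).2 : ℕ) < K (s.θ ω).1 := by
  have hm : MeasurableSet (s.θ ⁻¹' {j | ¬ (j.2 : ℕ) < K j.1}) := hs.meas_θ .of_discrete
  rw [ae_iff]
  show s.truncMeasure K (s.θ ⁻¹' {j | ¬ (j.2 : ℕ) < K j.1}) = 0
  rw [truncMeasure, withDensity_apply _ hm, setLIntegral_congr_fun (g := fun _ => 0) hm]
  · simp
  · intro ω hω
    exact if_neg hω

lemma truncMeasure_trunc (hs : s.Feasible X T) (h : ∀ m, K m ≤ K' m) (hK : ∀ m, 0 < K m)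
    (i : Idx K) : s.truncMeasure K ((fun ω => Idx.trunc hK (s.θ ω)) ⁻¹' {i}) =
      ENNReal.ofReal (1 / ((M : ℝ) * (K i.1 : ℝ))) := by
  rw [← hs.truncMeasure_singleton h hK i]
  refine measure_congr ?_
  filter_upwards [hs.ae_truncMeasure (K := K)] with ω hω
  refine propext ⟨fun e => ?_, fun e => ?_⟩
  · show s.θ ω = Idx.castLE h i
    rw [← show Idx.trunc hK (s.θ ω) = i from e, Idx.castLE_trunc h hK hω]
  · show Idx.trunc hK (s.θ ω) = i
    rw [show s.θ ω = Idx.castLE h i from e, Idx.trunc_castLE]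

lemma isProbabilityMeasure_truncMeasure (hM : 0 < M) (hs : s.Feasible X T)
    (h : ∀ m, K m ≤ K' m) (hK : ∀ m, 0 < K m) : IsProbabilityMeasure (s.truncMeasure K) := by
  have hmeas : Measurable fun ω => Idx.trunc hK (s.θ ω) :=
    (Measurable.of_discrete (f := Idx.trunc (K' := K') hK)).comp hs.meas_θ
  constructor
  rw [← Set.preimage_univ (f := fun ω => Idx.trunc hK (s.θ ω)), ← Finset.coe_univ,
    ← sum_measure_preimage_singleton _ fun i _ => hmeas .of_discrete,
    Finset.sum_congr rfl fun i _ => hs.truncMeasure_trunc h hK i,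
    ← ENNReal.ofReal_sum_of_nonneg fun _ _ => by positivity, Fintype.sum_sigma,
    Finset.sum_congr rfl (g := fun _ => (1 : ℝ) / M)]
  · have : (M : ℝ) ≠ 0 := by exact_mod_cast hM.ne'
    simp [this]
  · intro m _
    have : (K m : ℝ) ≠ 0 := by exact_mod_cast (hK m).ne'
    simp
    field_simp

lemma indep_storages_user_truncMeasure (hs : s.Feasible X T)
    [hp : IsProbabilityMeasure (s.truncMeasure K)] :
    IndepFun (fun ω n => s.storage n ω) (fun ω => (s.θ ω, fun i n => s.Q i n ω))
      (s.truncMeasure K) :=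
  let f : Idx K' × (Idx K' → Fin N → s.𝒬) → ℝ≥0∞ := fun p => truncWeight K K' p.1
  have hf : Measurable f := .of_discrete
  have : IsProbabilityMeasure (s.P.withDensity fun ω => f (s.θ ω, fun i n => s.Q i n ω)) := hp
  indepFun_withDensity (V := fun ω => (s.θ ω, fun i n => s.Q i n ω)) (f := f)
    hs.measurable_storages hs.measurable_user hs.indep_user hf

/-- The law of a function of the stored data does not depend on the choice of the message. -/
lemma map_truncMeasure_eq (hs : s.Feasible X T) [hp : IsProbabilityMeasure (s.truncMeasure K)]
    {γ : Type*} [MeasurableSpace γ] {Y : s.Ω → γ}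
    {G : ((n : Fin N) → {i : Idx K' // n ∈ R i.1} → s.𝒮) → γ}
    (hY : Y =ᵐ[s.P] fun ω => G fun n => s.storage n ω) :
    (s.truncMeasure K).map Y = s.P.map Y := by
  have hG : Measurable G := .of_discrete
  have : IsProbabilityMeasure (s.P.withDensity fun ω => truncWeight K K' (s.θ ω)) := hp
  have hind : IndepFun (fun ω n => s.storage n ω) s.θ s.P :=
    hs.indep_user.comp measurable_id measurable_fst
  have := map_withDensity_eq (hG.comp hs.measurable_storages) hs.meas_θ
    (hind.comp hG measurable_id) (f := truncWeight K K') .of_discrete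
  rw [Measure.map_congr hY, Measure.map_congr (s.absolutelyContinuous_truncMeasure.ae_le hY)]
  exact this

/-- The user is assumed independent of the storage only; statements about messages are transferred
through this dependence. -/
lemma exists_message_eq (hs : s.Feasible X T) :
    ∃ G : ((n : Fin N) → {i : Idx K' // n ∈ R i.1} → s.𝒮) → Idx K' → (Fin s.L → F),
      ∀ᵐ ω ∂s.P, (fun i => s.W i ω) = G fun n => s.storage n ω := by
  choose g hg using hs.recover
  refine ⟨fun S i => g i fun n => S n.1 ⟨i, n.2⟩, ?_⟩
  filter_upwards [ae_all_iff.2 hg] with ω hω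
  funext i
  exact hω i

lemma map_messages_truncMeasure (hs : s.Feasible X T)
    [IsProbabilityMeasure (s.truncMeasure K)] :
    (s.truncMeasure K).map (fun ω i => s.W i ω) = s.P.map (fun ω i => s.W i ω) := by
  obtain ⟨G, hG⟩ := hs.exists_message_eq
  exact hs.map_truncMeasure_eq hG

lemma map_message_truncMeasure (hs : s.Feasible X T)
    [IsProbabilityMeasure (s.truncMeasure K)] (i : Idx K') :
    (s.truncMeasure K).map (s.W i) = s.P.map (s.W i) := by
  obtain ⟨G, hG⟩ := hs.exists_message_eq
  exact hs.map_truncMeasure_eq (G := fun S => G S i) (hG.mono fun ω h => congrFun h i)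

lemma indep_shares_truncMeasure (hs : s.Feasible X T) [IsProbabilityMeasure (s.truncMeasure K)] :
    iIndepFun s.shares (s.truncMeasure K) := by
  have := hs.prob
  have h1 : (s.truncMeasure K).map (fun ω i => s.shares i ω) = s.P.map fun ω i => s.shares i ω :=
    hs.map_truncMeasure_eq (G := fun S i n => S n.1 ⟨i, n.2⟩) (Eventually.of_forall fun _ => rfl)
  have h2 : ∀ i, (s.truncMeasure K).map (s.shares i) = s.P.map (s.shares i) := fun i =>
    hs.map_truncMeasure_eq (G := fun S n => S n.1 ⟨i, n.2⟩) (Eventually.of_forall fun _ => rfl)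
  rw [iIndepFun_iff_map_fun_eq_pi_map fun i => (hs.measurable_shares i).aemeasurable, h1]
  simp_rw [h2]
  exact hs.indep_shares.map_fun_eq_pi_map fun i => (hs.measurable_shares i).aemeasurable

lemma indep_W_truncMeasure (hs : s.Feasible X T) [IsProbabilityMeasure (s.truncMeasure K)] :
    iIndepFun s.W (s.truncMeasure K) := by
  have := hs.prob
  rw [iIndepFun_iff_map_fun_eq_pi_map fun i => (hs.meas_W i).aemeasurable,
    hs.map_messages_truncMeasure]
  simp_rw [hs.map_message_truncMeasure]
  exact hs.indep_W.map_fun_eq_pi_map fun i => (hs.meas_W i).aemeasurable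

/-- The first `K` messages are independent of the user together with the other messages. -/
lemma indep_extended_user_truncMeasure (hs : s.Feasible X T) (h : ∀ m, K m ≤ K' m)
    [IsProbabilityMeasure (s.truncMeasure K)] :
    IndepFun (fun ω n (i : {i : Idx K // n ∈ R i.1}) => s.storage n ω ⟨Idx.castLE h i.1, i.2⟩)
      (fun ω => ((fun (j : {j : Idx K' // ¬ (j.2 : ℕ) < K j.1}) => s.shares j.1 ω),
        (s.θ ω, fun i n => s.Q i n ω))) (s.truncMeasure K) := by
  classical
  have hS : Measurable fun ω n (i : {i : Idx K // n ∈ R i.1}) =>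
      s.storage n ω ⟨Idx.castLE h i.1, i.2⟩ :=
    measurable_pi_lambda _ fun _ => measurable_pi_lambda _ fun _ => hs.meas_share _ _
  have hE : Measurable fun (ω : s.Ω) (j : {j : Idx K' // ¬ (j.2 : ℕ) < K j.1}) => s.shares j.1 ω :=
    measurable_pi_lambda _ fun _ => hs.measurable_shares _
  refine IndepFun.prodMk_of_prodMk hS hE hs.measurable_user ?_ ?_
  -- Kept and discarded messages form disjoint subfamilies of an independent family of share tuples.
  · have hdisj : Disjoint (Finset.univ.filter fun j : Idx K' => (j.2 : ℕ) < K j.1)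
        (Finset.univ.filter fun j : Idx K' => ¬ (j.2 : ℕ) < K j.1) :=
      Finset.disjoint_filter_filter_not _ _ _
    have hφ : Measurable fun (S : (j : (Finset.univ.filter fun j : Idx K' => (j.2 : ℕ) < K j.1)) →
        {n : Fin N // n ∈ R j.1.1} → s.𝒮) (n : Fin N) (i : {i : Idx K // n ∈ R i.1}) =>
          S ⟨Idx.castLE h i.1, by simp [Idx.castLE]⟩ ⟨n, i.2⟩ := .of_discrete
    have hψ : Measurable fun (S : (j : (Finset.univ.filter fun j : Idx K' => ¬ (j.2 : ℕ) < K j.1)) →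
        {n : Fin N // n ∈ R j.1.1} → s.𝒮) (j : {j : Idx K' // ¬ (j.2 : ℕ) < K j.1}) =>
          S ⟨j.1, by simpa using j.2⟩ := .of_discrete
    exact ((hs.indep_shares_truncMeasure (K := K)).indepFun_finset _ _ hdisj
      hs.measurable_shares).comp hφ hψ
  · exact (hs.indep_storages_user_truncMeasure (K := K)).comp
      (φ := fun S => ((fun n (i : {i : Idx K // n ∈ R i.1}) => S n ⟨Idx.castLE h i.1, i.2⟩),
        fun (j : {j : Idx K' // ¬ (j.2 : ℕ) < K j.1}) (n : {n : Fin N // n ∈ R j.1.1}) =>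
          S n.1 ⟨j.1, n.2⟩)) .of_discrete measurable_id

lemma secure_truncMeasure (hs : s.Feasible X T) [IsProbabilityMeasure (s.truncMeasure K)]
    {B : Finset (Fin N)} (hB : B.card ≤ X) :
    IndepFun (s.storageOn B) (fun ω i => s.W i ω) (s.truncMeasure K) := by
  have := hs.prob
  obtain ⟨G, hG⟩ := hs.exists_message_eq
  have hm1 : Measurable (s.storageOn B) :=
    measurable_pi_lambda _ fun _ => measurable_pi_lambda _ fun _ => hs.meas_share _ _
  have hm2 : Measurable fun ω i => s.W i ω := measurable_pi_lambda _ hs.meas_W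
  have h1 : (s.truncMeasure K).map (fun ω => (s.storageOn B ω, fun i => s.W i ω)) =
      s.P.map fun ω => (s.storageOn B ω, fun i => s.W i ω) :=
    hs.map_truncMeasure_eq (G := fun S => ((fun n : B => S n.1), G S))
      (hG.mono fun ω h => Prod.ext rfl h)
  have h2 : (s.truncMeasure K).map (s.storageOn B) = s.P.map (s.storageOn B) :=
    hs.map_truncMeasure_eq (G := fun S => fun n : B => S n.1) (Eventually.of_forall fun _ => rfl)
  have h3 := hs.secure B hB
  rw [indepFun_iff_map_prod_eq_prod_map_map hm1.aemeasurable hm2.aemeasurable] at h3 ⊢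
  rw [h1, h2, hs.map_messages_truncMeasure, h3]

variable [DiscreteMeasurableSpace F]

lemma law_W_truncMeasure (hs : s.Feasible X T)
    [IsProbabilityMeasure (s.truncMeasure K)] (i : Idx K') (w : Fin s.L → F) :
    (s.truncMeasure K).real (s.W i ⁻¹' {w}) = 1 / (Fintype.card F : ℝ) ^ s.L := by
  rw [← hs.law_W i w, ← map_measureReal_apply (hs.meas_W _) (measurableSet_singleton w),
    hs.map_message_truncMeasure, map_measureReal_apply (hs.meas_W _) (measurableSet_singleton w)]

/-- Conditions on the stored data survive because its law is unchanged, almost sure identities by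
absolute continuity, and conditions on the user because the density is a function of `θ`. -/
lemma restrict (hM : 0 < M) (hs : s.Feasible X T) (h : ∀ m, K m ≤ K' m) (hK : ∀ m, 0 < K m) :
    (s.restrict h hK).Feasible X T := by
  have hp := hs.isProbabilityMeasure_truncMeasure hM h hK
  have hprob := hs.prob
  have hθ : Measurable fun ω => Idx.trunc hK (s.θ ω) :=
    (Measurable.of_discrete (f := Idx.trunc (K' := K') hK)).comp hs.meas_θ
  have hE : Measurable fun (ω : s.Ω) (j : {j : Idx K' // ¬ (j.2 : ℕ) < K j.1}) => s.shares j.1 ω :=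
    measurable_pi_lambda _ fun _ => hs.measurable_shares _
  constructor
  case prob => exact hp
  case pos_L => exact hs.pos_L
  case meas_θ => exact hθ
  case meas_W => exact fun i => hs.meas_W _
  case meas_share => exact fun i n => hs.meas_share _ _
  case meas_Q => exact fun i n => (hs.measurable_sentQuery n).prodMk hE
  case law_θ =>
    intro i
    exact (congrArg ENNReal.toReal (hs.truncMeasure_trunc h hK i)).trans
      (ENNReal.toReal_ofReal (by positivity))
  case law_W =>
    intro i w
    exact hs.law_W_truncMeasure (Idx.castLE h i) w
  case indep_W => exact iIndepFun.precomp (g := Idx.castLE h) (Idx.castLE_injective h) hs.indep_W_truncMeasure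
  case indep_shares =>
    exact iIndepFun.precomp (g := Idx.castLE h) (Idx.castLE_injective h)
      hs.indep_shares_truncMeasure
  case recover =>
    intro i
    obtain ⟨g, hg⟩ := hs.recover (Idx.castLE h i)
    exact ⟨g, s.absolutelyContinuous_truncMeasure.ae_le hg⟩
  case secure =>
    intro B hB
    exact (hs.secure_truncMeasure (K := K) hB).comp
      (φ := fun S (n : B) (i : {i : Idx K // n.1 ∈ R i.1}) => S n ⟨Idx.castLE h i.1, i.2⟩)
      (ψ := fun w (i : Idx K) => w (Idx.castLE h i)) .of_discrete .of_discrete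
  case copy =>
    intro hX i n
    obtain ⟨c, hc, he⟩ := hs.copy hX (Idx.castLE h i) n
    exact ⟨c, hc, s.absolutelyContinuous_truncMeasure.ae_le he⟩
  case indep_user =>
    exact (hs.indep_extended_user_truncMeasure h).comp measurable_id
      (ψ := fun p => (Idx.trunc hK p.2.1, fun (_ : Idx K) n => (p.2.2 p.2.1 n, p.1))) .of_discrete
  case priv =>
    intro B hB
    have : IsProbabilityMeasure (s.P.withDensity fun ω => truncWeight K K' (s.θ ω)) := hp
    have h1 : IndepFun (fun ω => ((fun n : B => s.sentQuery n.1 ω), fun n => s.storage n ω)) s.θ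
        (s.truncMeasure K) :=
      indepFun_withDensity
        ((measurable_pi_lambda _ fun n : B => hs.measurable_sentQuery n.1).prodMk
          hs.measurable_storages) hs.meas_θ (hs.indep_θ_queries_storages hB).symm .of_discrete
    exact h1.comp
      (φ := fun p (n : B) => (p.1 n, fun (j : {j : Idx K' // ¬ (j.2 : ℕ) < K j.1})
        (n : {n : Fin N // n ∈ R j.1.1}) => p.2 n.1 ⟨j.1, n.2⟩))
      (ψ := Idx.trunc hK) .of_discrete .of_discrete
  case correct =>
    obtain ⟨dec, hdec⟩ := hs.correct
    refine ⟨fun A q i => dec A (fun n => (q n).1) (Idx.castLE h i), ?_⟩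
    have hdec' := s.absolutelyContinuous_truncMeasure (K := K) |>.ae_le hdec
    filter_upwards [hdec', hs.ae_truncMeasure (K := K)] with ω h1 h2
    simp_rw [restrict_sentAnswer]
    show s.W (Idx.castLE h (Idx.trunc hK (s.θ ω))) ω = dec _ _ (Idx.castLE h (Idx.trunc hK (s.θ ω)))
    rw [Idx.castLE_trunc h hK h2]
    exact h1

end Feasible

/-- One answer is a function of one query and the storage, hence independent of `θ` by privacy
against a single server. -/
lemma Feasible.entropy_sentAnswer_truncMeasure (hT : 1 ≤ T) (hs : s.Feasible X T)
    [hp : IsProbabilityMeasure (s.truncMeasure K)] (b : ℕ) (n : Fin N) :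
    entropy b (s.truncMeasure K) (s.sentAnswer n) = entropy b s.P (s.sentAnswer n) := by
  let : MeasurableSpace s.𝒜 := ⊤
  have hm : Measurable (fun ω => ((fun n : ({n} : Finset (Fin N)) => s.sentQuery n.1 ω),
      fun n => s.storage n ω)) :=
    (measurable_pi_lambda _ fun n : ({n} : Finset (Fin N)) => hs.measurable_sentQuery n.1).prodMk
      hs.measurable_storages
  have hg : Measurable fun p : (({n} : Finset (Fin N)) → s.𝒬) ×
      ((n : Fin N) → {i : Idx K' // n ∈ R i.1} → s.𝒮) =>
        s.answer n (p.1 ⟨n, by simp⟩) (p.2 n) := .of_discrete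
  have hA : Measurable (s.sentAnswer n) := hg.comp hm
  refine entropy_eq_of_map_eq _ hA hA ?_
  have : IsProbabilityMeasure (s.P.withDensity fun ω => truncWeight K K' (s.θ ω)) := hp
  exact map_withDensity_eq hA hs.meas_θ ((hs.indep_θ_queries_storages (B := {n})
    (by simpa using hT)).symm.comp hg measurable_id) .of_discrete

lemma Feasible.download_restrict (hT : 1 ≤ T) (hM : 0 < M) (hs : s.Feasible X T)
    (h : ∀ m, K m ≤ K' m) (hK : ∀ m, 0 < K m) : (s.restrict h hK).download = s.download := by
  have hp := hs.isProbabilityMeasure_truncMeasure hM h hK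
  refine Finset.sum_congr rfl fun n _ => ?_
  rw [restrict_sentAnswer]
  exact hs.entropy_sentAnswer_truncMeasure hT _ n

end Scheme

/-- The capacity decreases when messages are added. -/
lemma capacity_anti [Fintype F] [MeasurableSpace F] [DiscreteMeasurableSpace F] {X T : ℕ}
    (hT : 1 ≤ T) (hM : 0 < M) (h : ∀ m, K m ≤ K' m) (hK : ∀ m, 0 < K m) :
    capacity F X T R K' ≤ capacity F X T R K := by
  refine iSup₂_le fun s hs => ?_
  refine le_iSup₂_of_le (s.restrict h hK) (hs.restrict hM h hK) ?_
  rw [Scheme.rate, Scheme.rate, hs.download_restrict hT hM h hK]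
  rfl

end Restriction

/-! ### Masked polynomials and barycentric evaluation. -/

section Masking

open Polynomial

variable {E : Type} [Field E]

/-- The polynomial with value `a` at `b` whose other coefficients are masked by `z`. -/
noncomputable def maskPoly {d : ℕ} (b a : E) (z : Fin d → E) : E[X] :=
  C a + (C b - X) * ∑ x : Fin d, C (z x) * X ^ (x : ℕ)

lemma eval_maskPoly {d : ℕ} (b a : E) (z : Fin d → E) (t : E) :
    (maskPoly b a z).eval t = a + (b - t) * ∑ x : Fin d, z x * t ^ (x : ℕ) := by
  simp [maskPoly, eval_finsetSum]

@[simp] lemma eval_maskPoly_self {d : ℕ} (b a : E) (z : Fin d → E) :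
    (maskPoly b a z).eval b = a := by
  simp [eval_maskPoly]

lemma natDegree_maskPoly_le {d : ℕ} (b a : E) (z : Fin d → E) :
    (maskPoly b a z).natDegree ≤ d := by
  refine (natDegree_add_le _ _).trans (max_le (by simp) ?_)
  -- Without masks the truncated `d - 1` would give the bound `1` instead of `0`.
  rcases Nat.eq_zero_or_pos d with rfl | hd
  · simp
  · refine natDegree_mul_le.trans ?_
    have h1 : (C b - X : E[X]).natDegree ≤ 1 :=
      (natDegree_sub_le _ _).trans (by simp)
    have h2 : (∑ x : Fin d, C (z x) * X ^ (x : ℕ)).natDegree ≤ d - 1 :=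
      natDegree_sum_le_of_forall_le _ _ fun x _ =>
        (natDegree_C_mul_X_pow_le _ _).trans (by omega)
    omega

/-- On at most `d` points, the masking can absorb the value. -/
lemma exists_maskPoly_shift {ι : Type*} [DecidableEq ι] {α : ι → E} (hα : Function.Injective α)
    {b : E} (hb : ∀ n, b ≠ α n) {d : ℕ} {B : Finset ι} (hB : B.card ≤ d) (a : E) :
    ∃ y : Fin d → E, ∀ z : Fin d → E, ∀ n ∈ B,
      (maskPoly b a z).eval (α n) = (maskPoly b 0 (z + y)).eval (α n) := by
  -- Then `(b - α n) * p (α n) = a` on `B`, and `p` has degree below `d`, so its coefficients form a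
  -- mask.
  let p := Lagrange.interpolate B α fun n => a / (b - α n)
  refine ⟨fun x => p.coeff x, fun z n hn => ?_⟩
  have hdeg : p.degree < d :=
    (Lagrange.degree_interpolate_lt _ hα.injOn).trans_le (by exact_mod_cast hB)
  have heval : ∑ x : Fin d, p.coeff x * α n ^ (x : ℕ) = a / (b - α n) := by
    rw [← Lagrange.eval_interpolate_at_node (fun n => a / (b - α n)) hα.injOn hn]
    rcases eq_or_ne p 0 with h0 | h0
    · change _ = eval (α n) p
      simp [h0]
    · rw [eval_eq_sum_range' ((natDegree_lt_iff_degree_lt h0).2 hdeg), Finset.sum_range]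
  have hbn : b - α n ≠ 0 := sub_ne_zero.2 (hb n)
  simp only [eval_maskPoly, Pi.add_apply, add_mul, Finset.sum_add_distrib, heval]
  field_simp
  ring

/-- Evaluation at a point that is not a node, from the values at the nodes. -/
lemma sum_nodalWeight_mul_eval {ι : Type*} [DecidableEq ι] {s : Finset ι} {α : ι → E}
    (hα : Function.Injective α) {b : E} (hb : ∀ n, b ≠ α n) {p : E[X]}
    (hp : p.natDegree < s.card) :
    ∑ n ∈ s, Lagrange.nodalWeight s α n * (b - α n)⁻¹ * p.eval (α n) =
      p.eval b / (Lagrange.nodal s α).eval b := by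
  have hne : (Lagrange.nodal s α).eval b ≠ 0 :=
    Lagrange.eval_nodal_not_at_node fun i _ => hb i
  have hd : p.degree < s.card := degree_le_natDegree.trans_lt (by exact_mod_cast hp)
  have key := Lagrange.eval_interpolate_not_at_node (s := s) (v := α)
    (fun n => p.eval (α n)) (x := b) fun i _ => hb i
  rw [← Lagrange.eq_interpolate hα.injOn hd] at key
  rw [eq_div_iff hne, key, mul_comm]

end Masking

/-! ### The alignment scheme and its decoding. -/

section CrossSubspaceAlignment

variable {E F : Type} [Field E] [Fintype E] [MeasurableSpace E] [DiscreteMeasurableSpace E]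
  {N M : ℕ} {R : Fin M → Finset (Fin N)} {K : Fin M → ℕ} {ℓ X T r : ℕ}

/-- The law of the desired index. -/
noncomputable def indexLaw (K : Fin M → ℕ) : Measure (Idx K) :=
  ∑ i : Idx K, ENNReal.ofReal (1 / ((M : ℝ) * (K i.1 : ℝ))) • Measure.dirac i

lemma indexLaw_singleton (i : Idx K) :
    indexLaw K {i} = ENNReal.ofReal (1 / ((M : ℝ) * (K i.1 : ℝ))) := by
  simp [indexLaw, Measure.finsetSum_apply, Set.indicator_apply]

lemma isProbabilityMeasure_indexLaw (hM : 0 < M) (hK : ∀ m, 0 < K m) :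
    IsProbabilityMeasure (indexLaw K) := by
  constructor
  simp only [indexLaw, Measure.finsetSum_apply, Measure.smul_apply, measure_univ, smul_eq_mul,
    mul_one]
  rw [← ENNReal.ofReal_sum_of_nonneg fun _ _ => by positivity, Fintype.sum_sigma,
    Finset.sum_congr rfl (g := fun _ => (1 : ℝ) / M)]
  · have : (M : ℝ) ≠ 0 := by exact_mod_cast hM.ne'
    simp [this]
  · intro m _
    have : (K m : ℝ) ≠ 0 := by exact_mod_cast (hK m).ne'
    simp
    field_simp

/-- The law of the messages and of the masks of the shares. -/
noncomputable def dataLaw (E : Type) [Fintype E] [MeasurableSpace E] (K : Fin M → ℕ) (ℓ X : ℕ) :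
    Measure (Idx K → (Fin ℓ → E) × (Fin ℓ → Fin X → E)) :=
  Measure.pi fun _ => (uniformOn Set.univ).prod (uniformOn Set.univ)

/-- The law of the desired index and of the masks of the queries. -/
noncomputable def userLaw (E : Type) [Fintype E] [MeasurableSpace E] (K : Fin M → ℕ) (ℓ T : ℕ) :
    Measure (Idx K × (Idx K → Fin ℓ → Fin T → E)) :=
  (indexLaw K).prod (uniformOn Set.univ)

/-- The cross-subspace alignment scheme, in which shares and queries are evaluations of masked
polynomials, and the answers are weighted for the dual codes of the sets of servers `R m`. -/
noncomputable def alignmentScheme (R : Fin M → Finset (Fin N)) (K : Fin M → ℕ) (X T : ℕ)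
    (α : Fin N → E) (β : Fin ℓ → E) (φ : (Fin (ℓ * r) → F) ≃ (Fin ℓ → E)) : Scheme F R K where
  L := ℓ * r
  Ω := (Idx K × (Idx K → Fin ℓ → Fin T → E)) × (Idx K → (Fin ℓ → E) × (Fin ℓ → Fin X → E))
  𝒮 := Fin ℓ → E
  𝒬 := Idx K → Fin ℓ → E
  𝒜 := E
  P := (userLaw E K ℓ T).prod (dataLaw E K ℓ X)
  θ ω := ω.1.1
  -- `φ` is any bijection: all coding takes place over `E`, and no linearity over `F` is needed.
  W i ω := φ.symm (ω.2 i).1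
  share i n ω l := (maskPoly (β l) ((ω.2 i).1 l) ((ω.2 i).2 l)).eval (α n)
  Q i n ω j l := (maskPoly (β l) (if i = j then 1 else 0) (ω.1.2 j l)).eval (α n)
  answer n q S := ∑ i : {i : Idx K // n ∈ R i.1}, ∑ l : Fin ℓ,
    Lagrange.nodalWeight (R i.1.1) α n * (β l - α n)⁻¹ * (S i l * q i.1 l)

open Polynomial in
/-- Decoding: the interference is aligned away by any polynomial of degree below `ℓ`. -/
lemma alignmentScheme_sum_answer {α : Fin N → E} {β : Fin ℓ → E} (hα : Function.Injective α)
    (hβα : ∀ l n, β l ≠ α n) (φ : (Fin (ℓ * r) → F) ≃ (Fin ℓ → E))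
    (hR : ∀ m, ℓ + X + T ≤ (R m).card) {h : E[X]} (hh : h.natDegree < ℓ)
    (ω : (alignmentScheme R K X T α β φ).Ω) {A : Fin N → E}
    (hA : ∀ n, (alignmentScheme R K X T α β φ).sentAnswer n ω = A n) :
    ∑ n, h.eval (α n) * A n =
      ∑ l, h.eval (β l) * (ω.2 ω.1.1).1 l / (Lagrange.nodal (R ω.1.1.1) α).eval (β l) := by
  have hstep : ∀ n, A n = ∑ i : Idx K,
      if n ∈ R i.1 then ∑ l : Fin ℓ, Lagrange.nodalWeight (R i.1) α n * (β l - α n)⁻¹ *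
        ((maskPoly (β l) ((ω.2 i).1 l) ((ω.2 i).2 l)).eval (α n) *
          (maskPoly (β l) (if ω.1.1 = i then 1 else 0) (ω.1.2 i l)).eval (α n)) else 0 := by
    intro n
    rw [← hA, ← Finset.sum_filter, ← Finset.sum_subtype_eq_sum_filter, Finset.subtype_univ]
    rfl
  have hinner : ∀ (i : Idx K) (l : Fin ℓ), ∑ n ∈ R i.1, Lagrange.nodalWeight (R i.1) α n *
      (β l - α n)⁻¹ * (h * maskPoly (β l) ((ω.2 i).1 l) ((ω.2 i).2 l) *
        maskPoly (β l) (if ω.1.1 = i then 1 else 0) (ω.1.2 i l)).eval (α n) =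
      if ω.1.1 = i then h.eval (β l) * (ω.2 i).1 l / (Lagrange.nodal (R i.1) α).eval (β l)
        else 0 := by
    intro i l
    -- At `β l` both masks vanish, leaving symbol times indicator. The degree is at most `(ℓ - 1) +
    -- X + T`, which is less than `|R i.1|`.
    rw [sum_nodalWeight_mul_eval hα (hβα l)]
    · split_ifs <;> simp
    · have h1 := natDegree_maskPoly_le (β l) ((ω.2 i).1 l) ((ω.2 i).2 l)
      have h2 := natDegree_maskPoly_le (β l) (if ω.1.1 = i then 1 else 0) (ω.1.2 i l)
      have h3 := hR i.1
      refine natDegree_mul_le.trans_lt ?_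
      have := natDegree_mul_le (p := h) (q := maskPoly (β l) ((ω.2 i).1 l) ((ω.2 i).2 l))
      omega
  calc _ = ∑ i : Idx K, ∑ l : Fin ℓ, ∑ n ∈ R i.1, Lagrange.nodalWeight (R i.1) α n *
      (β l - α n)⁻¹ * (h * maskPoly (β l) ((ω.2 i).1 l) ((ω.2 i).2 l) *
        maskPoly (β l) (if ω.1.1 = i then 1 else 0) (ω.1.2 i l)).eval (α n) := by
        simp_rw [hstep, Finset.mul_sum]
        rw [Finset.sum_comm]
        refine Finset.sum_congr rfl fun i _ => ?_
        rw [Finset.sum_comm (s := Finset.univ (α := Fin ℓ))]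
        simp_rw [mul_ite, mul_zero]
        rw [← Finset.sum_filter, Finset.filter_mem_eq_inter, Finset.univ_inter]
        refine Finset.sum_congr rfl fun n _ => ?_
        rw [Finset.mul_sum]
        refine Finset.sum_congr rfl fun l _ => ?_
        rw [eval_mul, eval_mul]
        ring
    _ = _ := by
        simp_rw [hinner]
        rw [Finset.sum_comm]
        simp

/-- The symbols of the desired message from the answers. -/
lemma alignmentScheme_decode {α : Fin N → E} {β : Fin ℓ → E} (hα : Function.Injective α)
    (hβ : Function.Injective β) (hβα : ∀ l n, β l ≠ α n)
    (φ : (Fin (ℓ * r) → F) ≃ (Fin ℓ → E))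
    (hR : ∀ m, ℓ + X + T ≤ (R m).card) (ω : (alignmentScheme R K X T α β φ).Ω)
    {A : Fin N → E} (hA : ∀ n, (alignmentScheme R K X T α β φ).sentAnswer n ω = A n) (l : Fin ℓ) :
    (ω.2 ω.1.1).1 l = (Lagrange.nodal (R ω.1.1.1) α).eval (β l) *
      ∑ n, (Lagrange.basis Finset.univ β l).eval (α n) * A n := by
  have hne : (Lagrange.nodal (R ω.1.1.1) α).eval (β l) ≠ 0 :=
    Lagrange.eval_nodal_not_at_node fun i _ => hβα l i
  -- The basis polynomial is one at `β l` and zero at the other `β l'`, so it isolates the `l`-th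
  -- symbol.
  have hdeg : (Lagrange.basis Finset.univ β l).natDegree < ℓ := by
    have : (Lagrange.basis Finset.univ β l).natDegree = ℓ - 1 := by
      refine Polynomial.natDegree_eq_of_degree_eq_some ?_
      rw [Lagrange.degree_basis hβ.injOn (Finset.mem_univ l), Finset.card_univ, Fintype.card_fin]
    have := l.2
    omega
  rw [alignmentScheme_sum_answer hα hβα φ hR hdeg ω hA, Finset.sum_eq_single l]
  · rw [Lagrange.eval_basis_self hβ.injOn (Finset.mem_univ l)]
    field_simp
  · intro l' _ hl'
    rw [Lagrange.eval_basis_of_ne hl'.symm (Finset.mem_univ l')]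
    simp
  · simp

end CrossSubspaceAlignment

/-! ### Security, privacy, feasibility and rate of the alignment scheme. -/

section CrossSubspaceAlignment

variable {E F : Type} [Field E] [Fintype E] [MeasurableSpace E] [DiscreteMeasurableSpace E]
  {N M : ℕ} {R : Fin M → Finset (Fin N)} {K : Fin M → ℕ} {ℓ X T r : ℕ}

set_option synthInstance.maxSize 2000

instance isProbabilityMeasure_dataLaw : IsProbabilityMeasure (dataLaw E K ℓ X) := by
  have h1 : IsProbabilityMeasure (uniformOn (Set.univ : Set (Fin ℓ → E))) :=
    isProbabilityMeasure_uniformOn Set.finite_univ Set.univ_nonempty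
  have h2 : IsProbabilityMeasure (uniformOn (Set.univ : Set (Fin ℓ → Fin X → E))) :=
    isProbabilityMeasure_uniformOn Set.finite_univ Set.univ_nonempty
  unfold dataLaw
  infer_instance

/-- Fewer than `X + 1` shares reveal nothing about the messages. -/
lemma indepFun_shares_messages {α : Fin N → E} {β : Fin ℓ → E} (hα : Function.Injective α)
    (hβα : ∀ l n, β l ≠ α n) {B : Finset (Fin N)} (hB : B.card ≤ X) :
    IndepFun
      (fun (ω : Idx K → (Fin ℓ → E) × (Fin ℓ → Fin X → E)) (n : B) i l =>
        (maskPoly (β l) ((ω i).1 l) ((ω i).2 l)).eval (α n))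
      (fun ω i => (ω i).1) (dataLaw E K ℓ X) := by
  have h1 : IsProbabilityMeasure (uniformOn (Set.univ : Set (Fin ℓ → E))) :=
    isProbabilityMeasure_uniformOn Set.finite_univ Set.univ_nonempty
  have h2 : IsProbabilityMeasure (uniformOn (Set.univ : Set (Fin ℓ → Fin X → E))) :=
    isProbabilityMeasure_uniformOn Set.finite_univ Set.univ_nonempty
  choose y hy using fun l => exists_maskPoly_shift hα (hβα l) hB
  -- The shares seen in `B` are shares of the zero message under masks translated by a function of
  -- the messages; translation preserves the uniform law.
  let σ : (Idx K → Fin ℓ → E) → (Idx K → Fin ℓ → Fin X → E) → (Idx K → Fin ℓ → Fin X → E) :=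
    fun w z i l => z i l + y l (w i l)
  have hσ : ∀ w, MeasurePreserving (σ w)
      (Measure.pi fun _ => uniformOn Set.univ) (Measure.pi fun _ => uniformOn Set.univ) := fun w =>
    measurePreserving_pi _ _ fun i =>
      measurePreserving_uniformOn_univ (Equiv.addRight fun l => y l (w i l))
  have hind := (indepFun_skew_fst (μ := Measure.pi fun _ : Idx K =>
    uniformOn (Set.univ : Set (Fin ℓ → E))) (σ := σ) .of_discrete hσ).comp
      (φ := fun z (n : B) i l => (maskPoly (β l) 0 (z i l)).eval (α n)) .of_discrete measurable_id
  have := IndepFun.comp_measurePreserving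
    (measurePreserving_arrowProdEquivProdArrow (Fin ℓ → E) (Fin ℓ → Fin X → E) (Idx K)
      (fun _ => uniformOn Set.univ) (fun _ => uniformOn Set.univ)) .of_discrete .of_discrete hind
  convert! this using 2
  funext n i l
  exact hy l _ _ _ n.2

/-- Fewer than `T + 1` queries reveal nothing about the desired index. -/
lemma indepFun_queries_index {α : Fin N → E} {β : Fin ℓ → E} (hα : Function.Injective α)
    (hβα : ∀ l n, β l ≠ α n) {B : Finset (Fin N)} (hB : B.card ≤ T)
    [IsProbabilityMeasure (indexLaw K)] :
    IndepFun
      (fun (u : Idx K × (Idx K → Fin ℓ → Fin T → E)) (n : B) j l =>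
        (maskPoly (β l) (if u.1 = j then 1 else 0) (u.2 j l)).eval (α n))
      Prod.fst (userLaw E K ℓ T) := by
  have h1 : IsProbabilityMeasure (uniformOn (Set.univ : Set (Idx K → Fin ℓ → Fin T → E))) :=
    isProbabilityMeasure_uniformOn Set.finite_univ Set.univ_nonempty
  choose y hy using fun l => exists_maskPoly_shift hα (hβα l) hB
  -- The same translation argument, with the indicator of the desired index in place of the
  -- messages.
  let σ : Idx K → (Idx K → Fin ℓ → Fin T → E) → (Idx K → Fin ℓ → Fin T → E) :=
    fun i z j l => z j l + y l (if i = j then 1 else 0)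
  have hσ : ∀ i, MeasurePreserving (σ i) (uniformOn Set.univ) (uniformOn Set.univ) := fun i =>
    measurePreserving_uniformOn_univ (Equiv.addRight fun j l => y l (if i = j then 1 else 0))
  have := (indepFun_skew_fst (μ := indexLaw K) (σ := σ) .of_discrete hσ).comp
      (φ := fun z (n : B) j l => (maskPoly (β l) 0 (z j l)).eval (α n)) .of_discrete measurable_id
  convert! this using 2
  funext n j l
  exact hy l _ _ _ n.2

lemma feasible_alignmentScheme [Fintype F] [MeasurableSpace F] [DiscreteMeasurableSpace F]
    (hM : 0 < M) (hK : ∀ m, 0 < K m) {α : Fin N → E} {β : Fin ℓ → E} (hα : Function.Injective α)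
    (hβ : Function.Injective β) (hβα : ∀ l n, β l ≠ α n)
    (φ : (Fin (ℓ * r) → F) ≃ (Fin ℓ → E)) (hR : ∀ m, ℓ + X + T ≤ (R m).card)
    (hℓ : 0 < ℓ) (hr : 0 < r) : (alignmentScheme R K X T α β φ).Feasible X T := by
  have hp1 := isProbabilityMeasure_indexLaw hM hK
  have h1 : IsProbabilityMeasure (uniformOn (Set.univ : Set (Fin ℓ → E))) :=
    isProbabilityMeasure_uniformOn Set.finite_univ Set.univ_nonempty
  have h2 : IsProbabilityMeasure (uniformOn (Set.univ : Set (Fin ℓ → Fin X → E))) :=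
    isProbabilityMeasure_uniformOn Set.finite_univ Set.univ_nonempty
  have h3 : IsProbabilityMeasure (uniformOn (Set.univ : Set (Idx K → Fin ℓ → Fin T → E))) :=
    isProbabilityMeasure_uniformOn Set.finite_univ Set.univ_nonempty
  have hp2 : IsProbabilityMeasure (userLaw E K ℓ T) := by unfold userLaw; infer_instance
  have hsnd : MeasurePreserving Prod.snd ((userLaw E K ℓ T).prod (dataLaw E K ℓ X))
      (dataLaw E K ℓ X) := measurePreserving_snd
  have hfst : MeasurePreserving Prod.fst ((userLaw E K ℓ T).prod (dataLaw E K ℓ X))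
      (userLaw E K ℓ T) := measurePreserving_fst
  have hmeas : ∀ {γ : Type} [MeasurableSpace γ]
      (f : (Idx K × (Idx K → Fin ℓ → Fin T → E)) × (Idx K → (Fin ℓ → E) × (Fin ℓ → Fin X → E)) → γ),
      Measurable f := fun f => .of_discrete
  constructor
  case prob =>
    show IsProbabilityMeasure ((userLaw E K ℓ T).prod (dataLaw E K ℓ X))
    infer_instance
  case pos_L => exact Nat.mul_pos hℓ hr
  case meas_θ => exact hmeas _
  case meas_W => exact fun _ => hmeas _
  case meas_share => exact fun _ _ => hmeas _
  case meas_Q => exact fun _ _ => hmeas _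
  case law_θ =>
    intro i
    have hθ : MeasurePreserving Prod.fst (userLaw E K ℓ T) (indexLaw K) := measurePreserving_fst
    have := (hθ.comp hfst).measureReal_preimage (s := {i}) (MeasurableSet.of_discrete).nullMeasurableSet
    refine this.trans ?_
    rw [measureReal_def, indexLaw_singleton, ENNReal.toReal_ofReal (by positivity)]
  case law_W =>
    intro i w
    have hi : MeasurePreserving (Function.eval i) (dataLaw E K ℓ X)
      ((uniformOn Set.univ).prod (uniformOn Set.univ)) := measurePreserving_eval _ i
    have hw : MeasurePreserving Prod.fst ((uniformOn Set.univ).prod (uniformOn Set.univ))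
      (uniformOn (Set.univ : Set (Fin ℓ → E))) :=
      measurePreserving_fst (ν := uniformOn (Set.univ : Set (Fin ℓ → Fin X → E)))
    have := ((hw.comp hi).comp hsnd).measureReal_preimage (s := {φ w})
      (MeasurableSet.of_discrete).nullMeasurableSet
    rw [measureReal_def (uniformOn _), uniformOn_univ_singleton, ← Fintype.card_congr φ] at this
    refine Eq.trans ?_ (this.trans ?_)
    · congr 1
      ext ω
      exact φ.symm_apply_eq
    · simp [alignmentScheme]
  case indep_W =>
    exact iIndepFun.comp_measurePreserving hsnd (f := fun i ω => φ.symm (ω i).1)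
      (fun _ => .of_discrete)
      (iIndepFun_pi (X := fun _ (p : (Fin ℓ → E) × (Fin ℓ → Fin X → E)) => φ.symm p.1) fun _ => Measurable.of_discrete.aemeasurable)
  case indep_shares =>
    exact iIndepFun.comp_measurePreserving hsnd
      (f := fun i ω (n : {n // n ∈ R i.1}) l =>
        (maskPoly (β l) ((ω i).1 l) ((ω i).2 l)).eval (α n))
      (fun _ => .of_discrete)
      (iIndepFun_pi (X := fun (i : Idx K) (p : (Fin ℓ → E) × (Fin ℓ → Fin X → E))
        (n : {n // n ∈ R i.1}) l => (maskPoly (β l) (p.1 l) (p.2 l)).eval (α n)) fun _ => Measurable.of_discrete.aemeasurable)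
  case recover =>
    intro i
    -- Barycentric evaluation at `β l`, valid because the share polynomial has degree at most `X <
    -- |R i.1|`.
    refine ⟨fun S => φ.symm fun l => (Lagrange.nodal (R i.1) α).eval (β l) *
      ∑ n : {n // n ∈ R i.1}, Lagrange.nodalWeight (R i.1) α n * (β l - α n)⁻¹ * S n l,
      Eventually.of_forall fun ω => congrArg φ.symm (funext fun l => ?_)⟩
    have hne : (Lagrange.nodal (R i.1) α).eval (β l) ≠ 0 :=
      Lagrange.eval_nodal_not_at_node fun i _ => hβα l i
    have hdeg : (maskPoly (β l) ((ω.2 i).1 l) ((ω.2 i).2 l)).natDegree < (R i.1).card :=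
      (natDegree_maskPoly_le _ _ _).trans_lt (by have := hR i.1; omega)
    have := sum_nodalWeight_mul_eval hα (hβα l) hdeg
    rw [eval_maskPoly_self, eq_div_iff hne, mul_comm, ← Finset.sum_coe_sort] at this
    exact this.symm
  case secure =>
    intro B hB
    exact (IndepFun.comp_measurePreserving hsnd .of_discrete .of_discrete
      (indepFun_shares_messages hα hβα hB)).comp
        (φ := fun S (n : B) (i : {i : Idx K // n.1 ∈ R i.1}) => S n i.1)
        (ψ := fun w i => φ.symm (w i)) .of_discrete .of_discrete
  case copy =>
    -- With no masks the share polynomial is constant, so every share is `φ` of the message.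
    rintro rfl i n
    refine ⟨φ, φ.injective, Eventually.of_forall fun ω => funext fun l => ?_⟩
    show (maskPoly (β l) ((ω.2 i).1 l) ((ω.2 i).2 l)).eval (α n) = φ (φ.symm (ω.2 i).1) l
    simp [eval_maskPoly]
  case indep_user =>
    exact (indepFun_prod (μ := userLaw E K ℓ T) (ν := dataLaw E K ℓ X)
      (X := fun u => (u.1, fun i n j l =>
        (maskPoly (β l) (if i = j then 1 else 0) (u.2 j l)).eval (α n)))
      (Y := fun ω n (i : {i : Idx K // n ∈ R i.1}) l =>
        (maskPoly (β l) ((ω i.1).1 l) ((ω i.1).2 l)).eval (α n)) .of_discrete .of_discrete).symm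
  case priv =>
    intro B hB
    exact IndepFun.comp_measurePreserving hfst .of_discrete .of_discrete
      (indepFun_queries_index hα hβα hB)
  case correct =>
    exact ⟨fun (A : Fin N → E) _ i => φ.symm fun l => (Lagrange.nodal (R i.1) α).eval (β l) *
      ∑ n, (Lagrange.basis Finset.univ β l).eval (α n) * A n,
      Eventually.of_forall fun ω => congrArg φ.symm <| funext fun l =>
        alignmentScheme_decode hα hβ hβα φ hR ω (fun _ => rfl) l⟩

/-- Each answer is one symbol of `E`, of entropy at most `r`; since `L = ℓ * r`, the factor `r`
cancels. -/
lemma le_rate_alignmentScheme [Fintype F] [Nontrivial F] [MeasurableSpace F]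
    [DiscreteMeasurableSpace F]
    (hN : 0 < N) (hr : 0 < r) (hE : Fintype.card E = Fintype.card F ^ r) {α : Fin N → E}
    {β : Fin ℓ → E} (φ : (Fin (ℓ * r) → F) ≃ (Fin ℓ → E))
    (hs : (alignmentScheme R K X T α β φ).Feasible X T) :
    ENNReal.ofReal ((ℓ : ℝ) / N) ≤ (alignmentScheme R K X T α β φ).rate := by
  have hq : 1 < Fintype.card F := Fintype.one_lt_card
  have hlog : 0 < Real.log (Fintype.card F) := Real.log_pos (by exact_mod_cast hq)
  have hD : (alignmentScheme R K X T α β φ).download ≤ N * r := by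
    let A : Fin N → (Idx K × (Idx K → Fin ℓ → Fin T → E)) ×
      (Idx K → (Fin ℓ → E) × (Fin ℓ → Fin X → E)) → E :=
        (alignmentScheme R K X T α β φ).sentAnswer
    have hP : IsProbabilityMeasure ((userLaw E K ℓ T).prod (dataLaw E K ℓ X)) := hs.prob
    refine (Finset.sum_le_sum (g := fun _ => (r : ℝ)) fun n _ => ?_).trans (by simp)
    have hA : Measurable (A n) := .of_discrete
    refine (entropy_le_log_card hq ((userLaw E K ℓ T).prod (dataLaw E K ℓ X)) hA).trans (le_of_eq ?_)
    rw [hE]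
    push_cast
    rw [Real.log_pow]
    field_simp
  have hr' : (0 : ℝ) < r := by exact_mod_cast hr
  have hN' : (0 : ℝ) < N := by exact_mod_cast hN
  calc ENNReal.ofReal ((ℓ : ℝ) / N) = ENNReal.ofReal (((ℓ * r : ℕ) : ℝ) / (N * r)) := by
        congr 1
        push_cast
        field_simp
    _ = ((ℓ * r : ℕ) : ℝ≥0∞) / ENNReal.ofReal (N * r) := by
        rw [ENNReal.ofReal_div_of_pos (by positivity), ENNReal.ofReal_natCast]
    _ ≤ _ := ENNReal.div_le_div_left (ENNReal.ofReal_le_ofReal hD) _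

end CrossSubspaceAlignment

/-! ### The lower bound for finitely many messages, and the theorem. -/

/-- A finite field has finite extensions of any degree. -/
lemma exists_field_card_eq_pow (F : Type) [Field F] [Fintype F] {r : ℕ} (hr : 0 < r) :
    ∃ (E : Type) (_ : Field E) (_ : Fintype E), Fintype.card E = Fintype.card F ^ r := by
  obtain ⟨p, hp⟩ := CharP.exists F
  obtain ⟨n, hprime, hn⟩ := FiniteField.card F p
  have : Fact p.Prime := ⟨hprime⟩
  have := Fintype.ofFinite (GaloisField p (n * r))
  refine ⟨GaloisField p (n * r), inferInstance, this, ?_⟩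
  rw [← Nat.card_eq_fintype_card, GaloisField.card p _ (Nat.mul_pos n.pos hr).ne', hn, pow_mul]

lemma le_capacity (F : Type) [Field F] [Fintype F] [MeasurableSpace F] [DiscreteMeasurableSpace F]
    {N M X T ℓ : ℕ} (hM : 0 < M) (hN : 0 < N) (hℓ : 0 < ℓ) {R : Fin M → Finset (Fin N)}
    (hR : ∀ m, ℓ + X + T ≤ (R m).card) {K : Fin M → ℕ} (hK : ∀ m, 0 < K m) :
    ENNReal.ofReal ((ℓ : ℝ) / N) ≤ capacity F X T R K := by
  -- Since `q ^ r > r`, this degree leaves room for `N + ℓ` distinct points `α n`, `β l`.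
  obtain ⟨E, _, _, hE⟩ := exists_field_card_eq_pow F (r := N + ℓ) (by omega)
  let : MeasurableSpace E := ⊤
  have hcard : Fintype.card (Fin N ⊕ Fin ℓ) ≤ Fintype.card E := by
    rw [hE]
    simpa using (Nat.lt_pow_self (Fintype.one_lt_card (α := F)) (n := N + ℓ)).le
  obtain ⟨ι⟩ := Function.Embedding.nonempty_of_card_le hcard
  have hφ : Fintype.card (Fin (ℓ * (N + ℓ)) → F) = Fintype.card (Fin ℓ → E) := by
    simp [hE, ← pow_mul, mul_comm]
  have hs := feasible_alignmentScheme (X := X) (T := T) hM hK (α := ι ∘ Sum.inl)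
    (β := ι ∘ Sum.inr) (ι.injective.comp Sum.inl_injective) (ι.injective.comp Sum.inr_injective)
    (fun l n => ι.injective.ne (by simp)) (Fintype.equivOfCardEq hφ) hR hℓ (by omega)
  exact (le_rate_alignmentScheme hN (by omega) hE _ hs).trans (le_iSup₂_of_le _ hs le_rfl)

end GXSTPIR

theorem theorem1 (F : Type) [Field F] [Fintype F] [MeasurableSpace F] [DiscreteMeasurableSpace F]
    (N M X T : ℕ) (hM : 0 < M) (hX : X ≤ N) (hT : 1 ≤ T) (hTN : T ≤ N)
    (R : Fin M → Finset (Fin N)) (χ : Fin M → ℝ) (hχ : ∀ m, 0 < χ m) :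
    ∃ C : ℝ≥0∞, GXSTPIR.IsAsymptoticCapacity F X T R χ C ∧
      (((((GXSTPIR.rhoMin R : ℝ) - (X : ℝ) - (T : ℝ)) / (N : ℝ) : ℝ)) : EReal) ≤ (C : EReal) := by
  -- The sequence is shifted by one because at `K = 0` the message sets are empty and restriction to
  -- them is impossible.
  have hK : ∀ (k : ℕ) m, 0 < ⌈χ m * ((k + 1 : ℕ) : ℝ)⌉₊ := fun k m =>
    Nat.ceil_pos.2 (mul_pos (hχ m) (by positivity))
  have hanti : Antitone fun k : ℕ =>
      GXSTPIR.capacity F X T R fun m => ⌈χ m * ((k + 1 : ℕ) : ℝ)⌉₊ := fun k k' h =>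
    GXSTPIR.capacity_anti hT hM (fun m => Nat.ceil_mono
      (mul_le_mul_of_nonneg_left (by exact_mod_cast Nat.succ_le_succ h) (hχ m).le)) (hK k)
  refine ⟨_, (tendsto_add_atTop_iff_nat 1).1 (tendsto_atTop_iInf hanti), ?_⟩
  have hN : 0 < N := by omega
  rcases le_or_gt (GXSTPIR.rhoMin R) (X + T) with hle | hlt
  · have : ((GXSTPIR.rhoMin R : ℝ) - X - T) / N ≤ 0 := by
      refine div_nonpos_of_nonpos_of_nonneg ?_ (by positivity)
      have : (GXSTPIR.rhoMin R : ℝ) ≤ X + T := by exact_mod_cast hle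
      linarith
    exact (EReal.coe_le_coe_iff.2 this).trans (EReal.coe_ennreal_nonneg _)
  -- Here `ℓ + 1` equals `ρ_min - X - T`, the number of symbols that the alignment scheme retrieves.
  · obtain ⟨ℓ, hℓ⟩ := Nat.exists_eq_add_of_lt hlt
    have hρ : ((GXSTPIR.rhoMin R : ℝ) - X - T) = ((ℓ + 1 : ℕ) : ℝ) := by
      rw [hℓ]
      push_cast
      ring
    have hR : ∀ m, ℓ + 1 + X + T ≤ (R m).card := fun m => by
      have : GXSTPIR.rhoMin R ≤ (R m).card := ciInf_le (OrderBot.bddBelow _) m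
      omega
    rw [hρ]
    refine le_trans ?_ (EReal.coe_ennreal_le_coe_ennreal_iff.2
      (le_iInf fun k => GXSTPIR.le_capacity F hM hN ℓ.succ_pos hR (hK k)))
    rw [EReal.coe_ennreal_ofReal]
    exact EReal.coe_le_coe_iff.2 (le_max_left _ _)
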